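/- A **ballean** is a pair $(X,\mathcal E_X)$ of a non-empty set $X$ and a family $\mathcal E_X$ of subsets of $X\times X$ (called entourages) such that every $E\in\mathcal E_X$ contains the diagonal of $X\times X$; for any $E,F\in\mathcal E_X$ there is $D\in\mathcal E_X$ with $E\circ F^{-1}\subseteq D$, where $E\circ F=\{(x,z):\exists y\ (x,y)\in E,\ (y,z)\in F\}$ and $F^{-1}=\{(y,x):(x,y)\in F\}$; and $\bigcup\mathcal E_X=X\times X$. Put $E[x]=\{y:(x,y)\in E\}$ and $E[A]=\bigcup_{a\in A}E[a]$ for $E\subseteq X\times X$, $x\in X$, $A\subseteq X$. A set $B\subseteq X$ is **bounded** if $B\subseteq E[x]$ for some $E\in\mathcal E_X$ and $x\in X$; the family $\mathcal B_X$ of all bounded sets, ordered by inclusion, is the **bornology** of $X$, and it has a **linearly ordered base** if there is $\mathcal C\subseteq\mathcal B_X$, linearly ordered by inclusion, such that each $B\in\mathcal B_X$ is contained in some $C\in\mathcal C$. Sets $A,B\subseteq X$ are **asymptotically disjoint** if $E[A]\cap E[B]$ is bounded for every $E\in\mathcal E_X$, and $U\subseteq X$ is an **asymptotic neighborhood** of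 $A$ if $E[A]\setminus U$ is bounded for every $E\in\mathcal E_X$. The ballean $X$ is **normal** if any asymptotically disjoint sets $A,B\subseteq X$ have disjoint asymptotic neighborhoods, and **ultranormal** if $X$ contains no two asymptotically disjoint unbounded sets. It has **bounded growth** if there is $G\subseteq X\times X$ such that $G[B]$ is bounded for every bounded $B\subseteq X$, and for every $E\in\mathcal E_X$ there is a bounded set $B\subseteq X$ with $E[x]\subseteq G[x]$ for all $x\in X\setminus B$. The **hypersymmetric square** $[X]^{\le 2}$ of $X$ is the set of all non-empty bounded sets $A\subseteq X$ with $|A|\le 2$, endowed with the entourages $\{(A,B): A\subseteq E[B],\ B\subseteq E[A]\}$, $E\in\mathcal E_X$; it is again a ballean. **Theorem.** If for a ballean $X$ the hypersymmetric square $[X]^{\le 2}$ is normal, then 1. $X$ has bounded growth, and 2. $X$ is ultranormal or the bornology $\mathcal B_X$ of $X$ has a linearly ordered base (or both). -/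

import Mathlib

/-- A ballean structure on the set `X`: a family of entourages such that each entourage contains
the diagonal, for any entourages `E`, `F` some entourage contains `E ∘ F⁻¹`, and the entourages
cover `X × X`. Here `E.comp F = {(x, z) | ∃ y, (x, y) ∈ E ∧ (y, z) ∈ F}` and
`E.inv = {(y, x) | (x, y) ∈ E}`. -/
structure Ballean (X : Type*) where
  /-- The ball structure. -/
  entourages : Set (SetRel X X)
  diag_mem : ∀ E ∈ entourages, ∀ x, (x, x) ∈ E
  comp_inv : ∀ E ∈ entourages, ∀ F ∈ entourages, ∃ D ∈ entourages, E.comp F.inv ⊆ D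
  cover : ⋃₀ entourages = Set.univ

/-- A partially ordered set has a linearly ordered base if it contains a cofinal chain. -/
def HasLinearlyOrderedBase (P : Type*) [PartialOrder P] : Prop :=
  ∃ C : Set P, IsChain (· ≤ ·) C ∧ IsCofinal C

namespace Ballean

variable {X : Type*} (𝓔 : Ballean X)

/-- `B` is bounded if `B ⊆ E[x]` for some entourage `E` and some point `x`. Throughout,
`E[A]` is `E.image A = {y | ∃ a ∈ A, (a, y) ∈ E}` and `E[x]` is `E.image {x}`. -/
def IsBounded (B : Set X) : Prop :=
  ∃ E ∈ 𝓔.entourages, ∃ x : X, B ⊆ E.image {x}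

/-- The bornology: the family of all bounded subsets (ordered by inclusion). -/
def bornology : Set (Set X) := {B | 𝓔.IsBounded B}

/-- `E[A] ∩ E[B]` is bounded for every entourage `E`. -/
def AsympDisjoint (A B : Set X) : Prop :=
  ∀ E ∈ 𝓔.entourages, 𝓔.IsBounded (E.image A ∩ E.image B)

/-- `U` is an asymptotic neighborhood of `A`: `E[A] \ U` is bounded for every entourage `E`. -/
def IsAsympNhd (U A : Set X) : Prop :=
  ∀ E ∈ 𝓔.entourages, 𝓔.IsBounded (E.image A \ U)

/-- Any two asymptotically disjoint sets have disjoint asymptotic neighborhoods. -/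
def IsNormal : Prop :=
  ∀ A B : Set X, 𝓔.AsympDisjoint A B →
    ∃ U V : Set X, 𝓔.IsAsympNhd U A ∧ 𝓔.IsAsympNhd V B ∧ Disjoint U V

/-- There are no two asymptotically disjoint unbounded sets. -/
def IsUltranormal : Prop :=
  ¬ ∃ A B : Set X, ¬ 𝓔.IsBounded A ∧ ¬ 𝓔.IsBounded B ∧ 𝓔.AsympDisjoint A B

/-- There is a growth entourage `G`. -/
def HasBoundedGrowth : Prop :=
  ∃ G : SetRel X X,
    (∀ B : Set X, 𝓔.IsBounded B → 𝓔.IsBounded (G.image B)) ∧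
    ∀ E ∈ 𝓔.entourages, ∃ B : Set X, 𝓔.IsBounded B ∧ ∀ x ∉ B, E.image {x} ⊆ G.image {x}

/-- The subballean on `Y ⊆ X`, with entourages `(Y × Y) ∩ E`. -/
def subballean (Y : Set X) : Ballean Y where
  entourages := {F | ∃ E ∈ 𝓔.entourages, F = {p : Y × Y | ((p.1 : X), (p.2 : X)) ∈ E}}
  diag_mem := by
    rintro _ ⟨E, hE, rfl⟩ x
    exact 𝓔.diag_mem E hE x
  comp_inv := by
    rintro _ ⟨E, hE, rfl⟩ _ ⟨F, hF, rfl⟩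
    obtain ⟨D, hD, h⟩ := 𝓔.comp_inv E hE F hF
    refine ⟨_, ⟨D, hD, rfl⟩, ?_⟩
    rintro ⟨a, c⟩ ⟨b, hab, hbc⟩
    exact h ⟨b, hab, hbc⟩
  cover := by
    refine Set.eq_univ_of_forall fun p => ?_
    have hp : ((p.1 : X), (p.2 : X)) ∈ ⋃₀ 𝓔.entourages := by rw [𝓔.cover]; trivial
    obtain ⟨E, hE, h⟩ := hp
    exact ⟨_, ⟨E, hE, rfl⟩, h⟩

/-- The relation `Ê` on non-empty bounded sets: `A ⊆ E[B]` and `B ⊆ E[A]`. -/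
def hyperEntourage (E : SetRel X X) :
    SetRel {A : Set X // 𝓔.IsBounded A ∧ A.Nonempty} {A : Set X // 𝓔.IsBounded A ∧ A.Nonempty} :=
  {p | (p.1 : Set X) ⊆ E.image p.2 ∧ (p.2 : Set X) ⊆ E.image p.1}

lemma exists_inv_subset {F : SetRel X X} (hF : F ∈ 𝓔.entourages) :
    ∃ D ∈ 𝓔.entourages, ∀ x y, (x, y) ∈ F → (y, x) ∈ D := by
  obtain ⟨D, hD, h⟩ := 𝓔.comp_inv F hF F hF
  exact ⟨D, hD, fun x y hxy => h ⟨y, 𝓔.diag_mem F hF y, hxy⟩⟩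

lemma exists_comp_subset {E F : SetRel X X} (hE : E ∈ 𝓔.entourages) (hF : F ∈ 𝓔.entourages) :
    ∃ D ∈ 𝓔.entourages, ∀ x y z, (x, y) ∈ E → (y, z) ∈ F → (x, z) ∈ D := by
  obtain ⟨F', hF', h'⟩ := 𝓔.exists_inv_subset hF
  obtain ⟨D, hD, h⟩ := 𝓔.comp_inv E hE F' hF'
  exact ⟨D, hD, fun x y z hxy hyz => h ⟨y, hxy, h' y z hyz⟩⟩

/-- The hyperballean `[X]^𝓑` of all non-empty bounded subsets of `X`. -/
def hyperballean : Ballean {A : Set X // 𝓔.IsBounded A ∧ A.Nonempty} where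
  entourages := {H | ∃ E ∈ 𝓔.entourages, H = 𝓔.hyperEntourage E}
  diag_mem := by
    rintro _ ⟨E, hE, rfl⟩ A
    exact ⟨fun a ha => ⟨a, ha, 𝓔.diag_mem E hE a⟩, fun a ha => ⟨a, ha, 𝓔.diag_mem E hE a⟩⟩
  comp_inv := by
    rintro _ ⟨E, hE, rfl⟩ _ ⟨F, hF, rfl⟩
    obtain ⟨D₁, hD₁, h₁⟩ := 𝓔.exists_comp_subset hE hF
    obtain ⟨D₂, hD₂, h₂⟩ := 𝓔.exists_comp_subset hF hE
    obtain ⟨D, hD, h⟩ := 𝓔.exists_comp_subset hD₁ hD₂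
    refine ⟨_, ⟨D, hD, rfl⟩, ?_⟩
    rintro ⟨A, C⟩ ⟨B, ⟨hAB, hBA⟩, ⟨hCB, hBC⟩⟩
    constructor
    · intro a ha
      obtain ⟨b, hb, hba⟩ := hAB ha
      obtain ⟨c, hc, hcb⟩ := hBC hb
      exact ⟨c, hc, h c c a (𝓔.diag_mem _ hD₁ c) (h₂ c b a hcb hba)⟩
    · intro c hc
      obtain ⟨b, hb, hbc⟩ := hCB hc
      obtain ⟨a, ha, hab⟩ := hBA hb
      exact ⟨a, ha, h a c c (h₁ a b c hab hbc) (𝓔.diag_mem _ hD₂ c)⟩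
  cover := by
    refine Set.eq_univ_of_forall ?_
    rintro ⟨⟨A, ⟨E, hE, x, hA⟩, a, ha⟩, ⟨B, ⟨F, hF, y, hB⟩, b, hb⟩⟩
    have hp : ∀ p : X × X, p ∈ ⋃₀ 𝓔.entourages := fun p => by rw [𝓔.cover]; trivial
    obtain ⟨P, hP, hbx⟩ := hp (b, x)
    obtain ⟨Q, hQ, hay⟩ := hp (a, y)
    obtain ⟨D₁, hD₁, h₁⟩ := 𝓔.exists_comp_subset hP hE
    obtain ⟨D₂, hD₂, h₂⟩ := 𝓔.exists_comp_subset hQ hF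
    obtain ⟨D, hD, h⟩ := 𝓔.exists_comp_subset hD₁ hD₂
    refine ⟨_, ⟨D, hD, rfl⟩, ?_, ?_⟩
    · intro u hu
      obtain ⟨_, rfl, hxu⟩ := hA hu
      exact ⟨b, hb, h b u u (h₁ _ _ _ hbx hxu) (𝓔.diag_mem _ hD₂ u)⟩
    · intro u hu
      obtain ⟨_, rfl, hyu⟩ := hB hu
      exact ⟨a, ha, h a a u (𝓔.diag_mem _ hD₁ a) (h₂ _ _ _ hay hyu)⟩

/-- The hypersymmetric `n`-th power `[X]^{≤ n}`: the subballean of the hyperballean consisting of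
the non-empty (bounded) sets with at most `n` points. -/
def hypersymmetricPower (n : ℕ) :
    Ballean {A : {A : Set X // 𝓔.IsBounded A ∧ A.Nonempty} | (A : Set X).encard ≤ n} :=
  𝓔.hyperballean.subballean {A | (A : Set X).encard ≤ n}

end Ballean

namespace Ballean

/-! ### Calculus of entourages and bounded sets. -/

section Basic

variable {X : Type*} (𝓔 : Ballean X)

/-! Disjoint neighborhoods of families of pairs in the square are read as relations on `X`. For
growth, separate the pairs `{x, b}`, with `b` fixed, from the singletons `{x}`: the neighborhood of
the singletons, read as a relation, is a growth entourage, and its images of bounded sets are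
bounded because it misses the other neighborhood.

For the linear base, let `A`, `B` be unbounded and asymptotically disjoint. Separating the pairs
`{a, o}` from the pairs `{b, o}` gives a relation preserving boundedness under which every far `a ∈
A` reaches all of any given bounded part of `B` (`exists_dominating_rel`). Since `X` itself is
normal, `A` and `B` have disjoint neighborhoods `U`, `V`; as `Uᶜ ∪ Vᶜ = X`, combining the relations
from `A` to `Uᶜ`, `A` to `B` and `B` to `Vᶜ` lets `A` dominate every bounded set. Images of bounded
initial segments of a subset of `A` then form a cofinal chain. -/

lemma exists_entourage (x y : X) : ∃ E ∈ 𝓔.entourages, (x, y) ∈ E := by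
  have hp : (x, y) ∈ ⋃₀ 𝓔.entourages := by rw [𝓔.cover]; trivial
  exact hp

lemma exists_symm_supset {E : SetRel X X} (hE : E ∈ 𝓔.entourages) :
    ∃ D ∈ 𝓔.entourages, ∀ x y, (x, y) ∈ E → (x, y) ∈ D ∧ (y, x) ∈ D := by
  obtain ⟨F, hF, hEF⟩ := 𝓔.exists_inv_subset hE
  obtain ⟨D, hD, h⟩ := 𝓔.exists_comp_subset hE hF
  exact ⟨D, hD, fun x y hxy =>
    ⟨h x y y hxy (𝓔.diag_mem F hF y), h y y x (𝓔.diag_mem E hE y) (hEF x y hxy)⟩⟩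

lemma exists_union_subset {E F : SetRel X X} (hE : E ∈ 𝓔.entourages) (hF : F ∈ 𝓔.entourages) :
    ∃ D ∈ 𝓔.entourages, ∀ x y, (x, y) ∈ E ∨ (x, y) ∈ F → (x, y) ∈ D := by
  obtain ⟨D, hD, h⟩ := 𝓔.exists_comp_subset hE hF
  refine ⟨D, hD, fun x y hxy => ?_⟩
  rcases hxy with hxy | hxy
  · exact h x y y hxy (𝓔.diag_mem F hF y)
  · exact h x x y (𝓔.diag_mem E hE x) hxy

variable {𝓔}

lemma IsBounded.mono {A B : Set X} (hB : 𝓔.IsBounded B) (h : A ⊆ B) : 𝓔.IsBounded A := by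
  obtain ⟨E, hE, x, hx⟩ := hB
  exact ⟨E, hE, x, h.trans hx⟩

lemma IsBounded.exists_ball {B : Set X} (hB : 𝓔.IsBounded B) (b : X) :
    ∃ E ∈ 𝓔.entourages, ∀ y ∈ B, (b, y) ∈ E := by
  obtain ⟨E, hE, x, hx⟩ := hB
  obtain ⟨F, hF, hbx⟩ := 𝓔.exists_entourage b x
  obtain ⟨D, hD, h⟩ := 𝓔.exists_comp_subset hF hE
  refine ⟨D, hD, fun y hy => ?_⟩
  obtain ⟨_, rfl, hxy⟩ := hx hy
  exact h b _ y hbx hxy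

lemma isBounded_of_ball {B : Set X} {E : SetRel X X} (hE : E ∈ 𝓔.entourages) (b : X)
    (h : ∀ y ∈ B, (b, y) ∈ E) : 𝓔.IsBounded B :=
  ⟨E, hE, b, fun y hy => ⟨b, rfl, h y hy⟩⟩

lemma isBounded_singleton (x : X) : 𝓔.IsBounded {x} := by
  obtain ⟨E, hE, h⟩ := 𝓔.exists_entourage x x
  exact isBounded_of_ball hE x (by rintro _ rfl; exact h)

lemma IsBounded.union {A B : Set X} (hA : 𝓔.IsBounded A) (hB : 𝓔.IsBounded B) :
    𝓔.IsBounded (A ∪ B) := by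
  obtain ⟨E, hE, x, hx⟩ := hA
  obtain ⟨F, hF, hB⟩ := hB.exists_ball x
  obtain ⟨D, hD, h⟩ := 𝓔.exists_union_subset hE hF
  refine isBounded_of_ball hD x fun y hy => ?_
  rcases hy with hy | hy
  · obtain ⟨_, rfl, hxy⟩ := hx hy
    exact h _ y (Or.inl hxy)
  · exact h x y (Or.inr (hB y hy))

lemma isBounded_pair (x y : X) : 𝓔.IsBounded {x, y} :=
  (isBounded_singleton x).union (isBounded_singleton y)

lemma IsBounded.image {A : Set X} (hA : 𝓔.IsBounded A) {E : SetRel X X}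
    (hE : E ∈ 𝓔.entourages) : 𝓔.IsBounded (E.image A) := by
  obtain ⟨F, hF, x, hx⟩ := hA
  obtain ⟨D, hD, h⟩ := 𝓔.exists_comp_subset hF hE
  refine isBounded_of_ball hD x ?_
  rintro y ⟨a, ha, hay⟩
  obtain ⟨_, rfl, hxa⟩ := hx ha
  exact h _ a y hxa hay

lemma AsympDisjoint.exists_isBounded {A B : Set X} (h : 𝓔.AsympDisjoint A B)
    {E : SetRel X X} (hE : E ∈ 𝓔.entourages) :
    ∃ D, 𝓔.IsBounded D ∧ ∀ a ∈ A, ∀ b ∈ B, (b, a) ∈ E → a ∈ D :=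
  ⟨_, h E hE, fun a ha b hb hba => ⟨⟨a, ha, 𝓔.diag_mem E hE a⟩, ⟨b, hb, hba⟩⟩⟩

/-- A set is asymptotically disjoint from the complement of its asymptotic neighborhood. -/
lemma IsAsympNhd.asympDisjoint_compl {A U : Set X} (h : 𝓔.IsAsympNhd U A) :
    𝓔.AsympDisjoint A Uᶜ := by
  intro E hE
  obtain ⟨F, hF, hEF⟩ := 𝓔.exists_inv_subset hE
  obtain ⟨D, hD, hEFD⟩ := 𝓔.exists_comp_subset hE hF
  refine ((h D hD).image hE).mono ?_
  rintro z ⟨⟨a, ha, haz⟩, ⟨u, hu, huz⟩⟩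
  exact ⟨u, ⟨⟨a, ha, hEFD a z u haz (hEF u z huz)⟩, hu⟩, huz⟩

end Basic

/-! ### Relations on `X` from separated families of pairs. -/

section HypersymmetricSquare

variable {X : Type*} (𝓔 : Ballean X)

/-- The unordered pair `{x, y}` as a point of the hypersymmetric square. -/
def pair (x y : X) :
    {A : {A : Set X // 𝓔.IsBounded A ∧ A.Nonempty} | (A : Set X).encard ≤ (2 : ℕ)} :=
  ⟨⟨{x, y}, isBounded_pair x y, ⟨x, Or.inl rfl⟩⟩, by
    refine (Set.encard_insert_le {y} x).trans ?_
    rw [Set.encard_singleton]; norm_num⟩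

lemma pair_comm (x y : X) : 𝓔.pair x y = 𝓔.pair y x :=
  Subtype.ext (Subtype.ext (Set.pair_comm x y))

/-- The set of unordered pairs `{x, y}` with `(x, y) ∈ S`. -/
def pairs (S : Set (X × X)) :
    Set {A : {A : Set X // 𝓔.IsBounded A ∧ A.Nonempty} | (A : Set X).encard ≤ (2 : ℕ)} :=
  (fun p => 𝓔.pair p.1 p.2) '' S

variable {𝓔}

/-- A ball around a singleton `{x}` consists of the sets lying in a ball around `x`, so boundedness
in the power is boundedness of the union. -/
lemma isBounded_hypersymmetricPower_iff [Nonempty X] {n : ℕ} (hn : 1 ≤ n)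
    {P : Set {A : {A : Set X // 𝓔.IsBounded A ∧ A.Nonempty} | (A : Set X).encard ≤ n}} :
    (𝓔.hypersymmetricPower n).IsBounded P ↔
      ∃ D, 𝓔.IsBounded D ∧ ∀ p ∈ P, (p.1 : Set X) ⊆ D := by
  constructor
  · rintro ⟨_, ⟨_, ⟨E, hE, rfl⟩, rfl⟩, q, hq⟩
    refine ⟨_, q.1.2.1.image hE, fun p hp => ?_⟩
    obtain ⟨_, rfl, hqp⟩ := hq hp
    exact hqp.2
  · rintro ⟨D, hD, hP⟩
    obtain ⟨x⟩ := ‹Nonempty X›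
    obtain ⟨E, hE, hx⟩ := hD.exists_ball x
    obtain ⟨F, hF, hEF⟩ := 𝓔.exists_symm_supset hE
    refine isBounded_of_ball (𝓔 := 𝓔.hypersymmetricPower n) ⟨_, ⟨F, hF, rfl⟩, rfl⟩
      ⟨⟨{x}, isBounded_singleton x, ⟨x, rfl⟩⟩, by
        change ({x} : Set X).encard ≤ n
        rw [Set.encard_singleton]; exact_mod_cast hn⟩ fun p hp => ⟨?_, ?_⟩
    · rintro _ rfl
      obtain ⟨y, hy⟩ := p.1.2.2
      exact ⟨y, hy, (hEF _ y (hx y (hP p hp hy))).2⟩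
    · intro y hy
      exact ⟨x, rfl, (hEF x y (hx y (hP p hp hy))).1⟩

/-- If `r` is `E`-close to both `{x, y}` and `{u, v}`, then each of `x`, `y` is `E ∘ E`-close to `u`
or `v`; so it suffices to bound such `x` and `y`. -/
lemma asympDisjoint_pairs [Nonempty X] {S T : Set (X × X)}
    (h : ∀ E ∈ 𝓔.entourages, ∃ D, 𝓔.IsBounded D ∧ ∀ x y u v, (x, y) ∈ S → (u, v) ∈ T →
      (u, x) ∈ E ∨ (v, x) ∈ E → (u, y) ∈ E ∨ (v, y) ∈ E → x ∈ D ∧ y ∈ D) :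
    (𝓔.hypersymmetricPower 2).AsympDisjoint (𝓔.pairs S) (𝓔.pairs T) := by
  rintro _ ⟨_, ⟨E, hE, rfl⟩, rfl⟩
  obtain ⟨F, hF, hEF⟩ := 𝓔.exists_comp_subset hE hE
  obtain ⟨D, hD, hST⟩ := h F hF
  refine (isBounded_hypersymmetricPower_iff one_le_two).2 ⟨_, hD.image hE, ?_⟩
  rintro r ⟨⟨_, ⟨⟨x, y⟩, hxy, rfl⟩, hpr, hrp⟩, ⟨_, ⟨⟨u, v⟩, huv, rfl⟩, hqr, hrq⟩⟩
  have key : ∀ z, z ∈ ({x, y} : Set X) → (u, z) ∈ F ∨ (v, z) ∈ F := by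
    intro z hz
    obtain ⟨w, hw, hwz⟩ := hpr hz
    obtain ⟨t, ht, htw⟩ := hrq hw
    rcases ht with rfl | rfl
    · exact Or.inl (hEF _ w z htw hwz)
    · exact Or.inr (hEF _ w z htw hwz)
  obtain ⟨hx, hy⟩ := hST x y u v hxy huv (key x (Or.inl rfl)) (key y (Or.inr rfl))
  intro z hz
  obtain ⟨w, hw, hwz⟩ := hrp hz
  rcases hw with rfl | rfl
  · exact ⟨_, hx, hwz⟩
  · exact ⟨_, hy, hwz⟩

/-- The pairs near `pairs S` that `U` misses have bounded union, so a single far point forces a pair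
into `U`. -/
lemma exists_isBounded_pair_mem [Nonempty X] {S : Set (X × X)}
    {U : Set {A : {A : Set X // 𝓔.IsBounded A ∧ A.Nonempty} | (A : Set X).encard ≤ (2 : ℕ)}}
    (hU : (𝓔.hypersymmetricPower 2).IsAsympNhd U (𝓔.pairs S))
    {E : SetRel X X} (hE : E ∈ 𝓔.entourages) :
    ∃ C, 𝓔.IsBounded C ∧ ∀ x y x' y', (x, y) ∈ S → (x, x') ∈ E → (y, y') ∈ E → x' ∉ C →
      𝓔.pair x' y' ∈ U := by
  obtain ⟨F, hF, hEF⟩ := 𝓔.exists_symm_supset hE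
  obtain ⟨C, hC, h⟩ := (isBounded_hypersymmetricPower_iff one_le_two).1
    (hU _ ⟨_, ⟨F, hF, rfl⟩, rfl⟩)
  refine ⟨C, hC, fun x y x' y' hxy hx hy hxC => ?_⟩
  by_contra hn
  refine hxC (h (𝓔.pair x' y') ⟨⟨𝓔.pair x y, ⟨(x, y), hxy, rfl⟩, ?_, ?_⟩, hn⟩ (Or.inl rfl))
  · rintro z (rfl | rfl)
    · exact ⟨x', Or.inl rfl, (hEF _ _ hx).2⟩
    · exact ⟨y', Or.inr rfl, (hEF _ _ hy).2⟩
  · rintro z (rfl | rfl)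
    · exact ⟨x, Or.inl rfl, (hEF _ _ hx).1⟩
    · exact ⟨y, Or.inr rfl, (hEF _ _ hy).1⟩

lemma hasBoundedGrowth_of_isNormal [Nonempty X] (h : (𝓔.hypersymmetricPower 2).IsNormal) :
    𝓔.HasBoundedGrowth := by
  obtain ⟨b⟩ := ‹Nonempty X›
  have : Nonempty X := ⟨b⟩
  obtain ⟨U, V, hU, hV, hUV⟩ := h (𝓔.pairs {p | p.2 = b}) (𝓔.pairs {p | p.1 = p.2}) <| by
    refine asympDisjoint_pairs fun E hE => ?_
    obtain ⟨F, hF, hEF⟩ := 𝓔.exists_inv_subset hE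
    obtain ⟨D, hD, hFED⟩ := 𝓔.exists_comp_subset hF hE
    refine ⟨_, ((isBounded_singleton b).image hD).union (isBounded_singleton b), ?_⟩
    rintro x y u v (rfl : y = b) (rfl : u = v) hx hy
    rw [or_self] at hx hy
    -- A singleton `{u}` close to `{x, b}` puts `x` in a ball around `b` by way of `u`.
    exact ⟨Or.inl ⟨y, rfl, hFED y u x (hEF u y hy) hx⟩, Or.inr rfl⟩
  refine ⟨{p | 𝓔.pair p.1 p.2 ∈ V}, fun B hB => ?_, fun E hE => ?_⟩
  · obtain ⟨E, hE, hBE⟩ := hB.exists_ball b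
    obtain ⟨C, hC, hCU⟩ := exists_isBounded_pair_mem hU hE
    refine hC.mono ?_
    rintro y ⟨x, hx, hxy⟩
    by_contra hy
    -- For `x` near `b`, the pair `{y, x}` is close to `{y, b}`, hence in `U` when `y` is far.
    refine Set.disjoint_left.1 hUV (hCU y b y x rfl (𝓔.diag_mem E hE y) (hBE x hx) hy) ?_
    rw [pair_comm]
    exact hxy
  · obtain ⟨C, hC, hCV⟩ := exists_isBounded_pair_mem hV hE
    refine ⟨C, hC, fun x hx => ?_⟩
    rintro y ⟨_, rfl, hxy⟩
    exact ⟨_, rfl, hCV _ _ _ y rfl (𝓔.diag_mem E hE _) hxy hx⟩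

/-- A ballean with normal hypersymmetric square is normal. -/
lemma isNormal_of_isNormal_hypersymmetricPower [Nonempty X]
    (h : (𝓔.hypersymmetricPower 2).IsNormal) : 𝓔.IsNormal := by
  intro A B hAB
  obtain ⟨U, V, hU, hV, hUV⟩ :=
      h (𝓔.pairs {p | p.1 ∈ A ∧ p.1 = p.2}) (𝓔.pairs {p | p.1 ∈ B ∧ p.1 = p.2}) <| by
    refine asympDisjoint_pairs fun E hE => ?_
    obtain ⟨D, hD, hABD⟩ := hAB.exists_isBounded hE
    refine ⟨D, hD, ?_⟩
    rintro x y u v ⟨hx, hxy⟩ ⟨hu, huv⟩ hux -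
    obtain rfl : x = y := hxy
    obtain rfl : u = v := huv
    rw [or_self] at hux
    exact ⟨hABD x hx u hu hux, hABD x hx u hu hux⟩
  have nhd : ∀ {W A}, (𝓔.hypersymmetricPower 2).IsAsympNhd W
      (𝓔.pairs {p | p.1 ∈ A ∧ p.1 = p.2}) → 𝓔.IsAsympNhd {x | 𝓔.pair x x ∈ W} A := by
    intro W A hW E hE
    obtain ⟨C, hC, hCW⟩ := exists_isBounded_pair_mem hW hE
    refine hC.mono ?_
    rintro y ⟨⟨a, ha, hay⟩, hy⟩
    by_contra hyC
    exact hy (hCW a a y y ⟨ha, rfl⟩ hay hay hyC)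
  exact ⟨_, _, nhd hU, nhd hV, Set.disjoint_left.2 fun x hxU hxV =>
    Set.disjoint_left.1 hUV hxU hxV⟩

/-- Points of `A` far away dominate, through a bornologous relation, the bounded subsets of a
set `B` that is asymptotically disjoint from `A`. -/
lemma exists_dominating_rel [Nonempty X] (h : (𝓔.hypersymmetricPower 2).IsNormal)
    {A B : Set X} (hAB : 𝓔.AsympDisjoint A B) :
    ∃ R : SetRel X X, (∀ C, 𝓔.IsBounded C → 𝓔.IsBounded (R.image C)) ∧
      ∀ D, 𝓔.IsBounded D → D ⊆ B →
        ∃ C, 𝓔.IsBounded C ∧ ∀ a ∈ A, a ∉ C → ∀ d ∈ D, (a, d) ∈ R := by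
  obtain ⟨o⟩ := ‹Nonempty X›
  have : Nonempty X := ⟨o⟩
  obtain ⟨U, V, hU, hV, hUV⟩ :=
      h (𝓔.pairs {p | p.1 ∈ A ∧ p.2 = o}) (𝓔.pairs {p | p.1 ∈ B ∧ p.2 = o}) <| by
    refine asympDisjoint_pairs fun E hE => ?_
    obtain ⟨D, hD, hABD⟩ := hAB.exists_isBounded hE
    refine ⟨_, (hD.union ((isBounded_singleton o).image hE)).union (isBounded_singleton o), ?_⟩
    rintro x y u v ⟨hx, hy⟩ ⟨hu, hv⟩ hux -
    obtain rfl : y = o := hy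
    obtain rfl : v = y := hv
    refine ⟨Or.inl ?_, Or.inr rfl⟩
    rcases hux with hux | hvx
    · exact Or.inl (hABD x hx u hu hux)
    · exact Or.inr ⟨v, rfl, hvx⟩
  -- The restriction `p.2 ∈ B` lets the neighborhood `V` of the pairs `{b, o}` bound the images of
  -- bounded sets.
  refine ⟨{p | p.2 ∈ B ∧ 𝓔.pair p.1 p.2 ∈ U}, fun C hC => ?_, fun D hD hDB => ?_⟩
  · obtain ⟨E, hE, hCE⟩ := hC.exists_ball o
    obtain ⟨D, hD, hDV⟩ := exists_isBounded_pair_mem hV hE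
    refine hD.mono ?_
    rintro b ⟨c, hc, hb, hcb⟩
    by_contra hbD
    refine Set.disjoint_left.1 hUV hcb ?_
    have := hDV b o b c ⟨hb, rfl⟩ (𝓔.diag_mem E hE b) (hCE c hc) hbD
    rwa [pair_comm] at this
  · obtain ⟨E, hE, hDE⟩ := hD.exists_ball o
    obtain ⟨C, hC, hCU⟩ := exists_isBounded_pair_mem hU hE
    exact ⟨C, hC, fun a ha haC d hd =>
      ⟨hDB hd, hCU a o a d ⟨ha, rfl⟩ (𝓔.diag_mem E hE a) (hDE d hd) haC⟩⟩

end HypersymmetricSquare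

/-! ### From domination to a cofinal chain of bounded sets. -/

section LinearlyOrderedBase

variable {X : Type*} {𝓔 : Ballean X}

/-- Every unbounded set contains an unbounded set whose initial segments, in a suitable linear
order, are bounded. -/
lemma exists_isBounded_initialSegments {A : Set X} (hA : ¬ 𝓔.IsBounded A) :
    ∃ (_ : LinearOrder X) (S : Set X), S ⊆ A ∧ ¬ 𝓔.IsBounded S ∧
      ∀ z ∈ S, 𝓔.IsBounded {y | y ∈ S ∧ y ≤ z} := by
  obtain ⟨_, hwf⟩ := exists_wellFoundedLT X
  suffices H : ∃ S ⊆ A, ¬ 𝓔.IsBounded S ∧ ∀ z ∈ S, 𝓔.IsBounded {y | y ∈ S ∧ y < z} by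
    obtain ⟨S, hSA, hS, hz⟩ := H
    refine ⟨inferInstance, S, hSA, hS, fun z hzS => ?_⟩
    refine ((hz z hzS).union (isBounded_singleton z)).mono ?_
    rintro y ⟨hyS, hyz⟩
    rcases hyz.lt_or_eq with hlt | rfl
    · exact Or.inl ⟨hyS, hlt⟩
    · exact Or.inr rfl
  -- Cut `A` at the least point whose initial segment in `A` is unbounded; if there is none, `A`
  -- itself works.
  by_cases hne : ({x | ¬ 𝓔.IsBounded {y | y ∈ A ∧ y < x}} : Set X).Nonempty
  · obtain ⟨x, hx, hmin⟩ := WellFounded.has_min (wellFounded_lt (α := X)) _ hne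
    refine ⟨{y | y ∈ A ∧ y < x}, fun y hy => hy.1, hx, fun z hz => ?_⟩
    by_contra hzb
    exact hmin z (fun hb => hzb (hb.mono fun y hy => ⟨hy.1.1, hy.2⟩)) hz.2
  · refine ⟨A, subset_rfl, hA, fun z _ => ?_⟩
    by_contra hz
    exact hne ⟨z, hz⟩

/-- If points of an unbounded set dominate all bounded sets through a bornologous relation, then
the bornology has a linearly ordered base. -/
lemma hasLinearlyOrderedBase_of_dominating_rel {A : Set X} (hA : ¬ 𝓔.IsBounded A)
    {R : SetRel X X} (hR : ∀ C, 𝓔.IsBounded C → 𝓔.IsBounded (R.image C))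
    (hdom : ∀ D, 𝓔.IsBounded D →
      ∃ C, 𝓔.IsBounded C ∧ ∀ a ∈ A, a ∉ C → ∀ d ∈ D, (a, d) ∈ R) :
    HasLinearlyOrderedBase 𝓔.bornology := by
  obtain ⟨_, S, hSA, hS, hseg⟩ := exists_isBounded_initialSegments hA
  have mono : ∀ {z w : X}, z ≤ w →
      R.image {y | y ∈ S ∧ y ≤ z} ⊆ R.image {y | y ∈ S ∧ y ≤ w} := by
    rintro z w hzw x ⟨y, hy, hyx⟩
    exact ⟨y, ⟨hy.1, hy.2.trans hzw⟩, hyx⟩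
  refine ⟨Set.range fun z : S => (⟨R.image {y | y ∈ S ∧ y ≤ (z : X)}, hR _ (hseg z z.2)⟩ :
    𝓔.bornology), ?_, ?_⟩
  · rintro _ ⟨z, rfl⟩ _ ⟨w, rfl⟩ -
    rcases le_total (z : X) w with hzw | hzw
    · exact Or.inl (mono hzw)
    · exact Or.inr (mono hzw)
  · rintro ⟨D, hD⟩
    obtain ⟨C, hC, hCD⟩ := hdom D hD
    obtain ⟨a, haS, haC⟩ : ∃ a ∈ S, a ∉ C := by
      by_contra! hSC
      exact hS (hC.mono hSC)
    exact ⟨_, ⟨⟨a, haS⟩, rfl⟩, fun d hd => ⟨a, ⟨haS, le_rfl⟩, hCD a (hSA haS) haC d hd⟩⟩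

/-- The part of a bounded set outside `U` is reached from `A` directly, and the part inside `U` lies
outside `V`, so it is reached through a point of `B`. -/
lemma hasLinearlyOrderedBase_of_isNormal [Nonempty X]
    (h : (𝓔.hypersymmetricPower 2).IsNormal) {A B : Set X} (hA : ¬ 𝓔.IsBounded A)
    (hB : ¬ 𝓔.IsBounded B) (hAB : 𝓔.AsympDisjoint A B) :
    HasLinearlyOrderedBase 𝓔.bornology := by
  obtain ⟨U, V, hU, hV, hUV⟩ := isNormal_of_isNormal_hypersymmetricPower h A B hAB
  obtain ⟨R, hR, hRdom⟩ := exists_dominating_rel h hU.asympDisjoint_compl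
  obtain ⟨Q, hQ, hQdom⟩ := exists_dominating_rel h hV.asympDisjoint_compl
  obtain ⟨T, hT, hTdom⟩ := exists_dominating_rel h hAB
  refine hasLinearlyOrderedBase_of_dominating_rel hA
    (R := {p | p ∈ R ∨ ∃ b, (p.1, b) ∈ T ∧ (b, p.2) ∈ Q}) (fun C hC => ?_) fun D hD => ?_
  · refine ((hR C hC).union (hQ _ (hT C hC))).mono ?_
    rintro d ⟨c, hc, hcd | ⟨b, hcb, hbd⟩⟩
    · exact Or.inl ⟨c, hc, hcd⟩
    · exact Or.inr ⟨b, ⟨c, hc, hcb⟩, hbd⟩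
  · obtain ⟨C₁, hC₁, h₁⟩ := hRdom (D ∩ Uᶜ) (hD.mono Set.inter_subset_left) Set.inter_subset_right
    obtain ⟨C₂, hC₂, h₂⟩ := hQdom (D ∩ Vᶜ) (hD.mono Set.inter_subset_left) Set.inter_subset_right
    -- One far relay point `b`, depending only on `D`, serves every far `a`.
    obtain ⟨b, hbB, hbC⟩ : ∃ b ∈ B, b ∉ C₂ := by
      by_contra! hBC
      exact hB (hC₂.mono hBC)
    obtain ⟨C₃, hC₃, h₃⟩ := hTdom {b} (isBounded_singleton b) (by rintro _ rfl; exact hbB)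
    refine ⟨C₁ ∪ C₃, hC₁.union hC₃, fun a ha haC d hd => ?_⟩
    by_cases hdU : d ∈ U
    · exact Or.inr ⟨b, h₃ a ha (fun hc => haC (Or.inr hc)) b rfl,
        h₂ b hbB hbC d ⟨hd, Set.disjoint_left.1 hUV hdU⟩⟩
    · exact Or.inl (h₁ a ha (fun hc => haC (Or.inl hc)) d ⟨hd, hdU⟩)

end LinearlyOrderedBase

end Ballean

theorem theorem1p8 {X : Type*} [Nonempty X] (𝓔 : Ballean X)
    (h : (𝓔.hypersymmetricPower 2).IsNormal) :
    𝓔.HasBoundedGrowth ∧ (𝓔.IsUltranormal ∨ HasLinearlyOrderedBase 𝓔.bornology) := by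
  refine ⟨Ballean.hasBoundedGrowth_of_isNormal h, or_iff_not_imp_left.2 fun hu => ?_⟩
  obtain ⟨A, B, hA, hB, hAB⟩ := not_not.1 hu
  exact Ballean.hasLinearlyOrderedBase_of_isNormal h hA hB hAB
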